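/- Let $\mathcal H=\ell^2(\mathbf Z^2)$, let $\mathcal L(\mathcal H)$ be the algebra of bounded operators on $\mathcal H$ and $\mathcal K(\mathcal H)$ the ideal of compact operators. The essential spectrum $\sigma_{\rm ess}(x)$ of $x\in\mathcal L(\mathcal H)$ is the spectrum of the image of $x$ in $\mathcal L(\mathcal H)/\mathcal K(\mathcal H)$. For $n\ge 1$ let $p_n$ and $q_n$ be the projections $$(p_n\phi)(i,j)=\begin{cases}\phi(i,j)&\text{if }-n\le i\le n,\\0&\text{otherwise,}\end{cases}\qquad (q_n\phi)(i,j)=\begin{cases}\phi(i,j)&\text{if }-n\le j\le n,\\0&\text{otherwise.}\end{cases}$$ Let $\mathcal J_1$ be the norm closure of $\{x\in\mathcal L(\mathcal H):\exists n\ge1,\ p_nx=xp_n=x\}$, let $\mathcal J_2$ be the norm closure of $\{x\in\mathcal L(\mathcal H):\exists n\ge 1,\ q_nx=xq_n=x\}$, and put $$\mathcal A=\{x\in\mathcal L(\mathcal H): x\mathcal J_r\subseteq\mathcal J_r\text{ and }\mathcal J_rx\subseteq\mathcal J_r\text{ for }r=1,2\}.$$ For $x\in\mathcal A$ let $\sigma_r(x)$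 be the spectrum of the image of $x$ in $\mathcal A/\mathcal J_r$ ($r=1,2$). Let $A$ be a discrete Schrödinger operator $(A\phi)(x)=\sum_{r=1}^m c_r(x)\,\phi(x+b_r)$ with $b_r\in\mathbf Z^2$ and bounded coefficients $c_r:\mathbf Z^2\to\mathbf C$, which is periodic in both coordinate directions: for some integers $k_1,k_2\ge1$ it commutes with the translations $\phi(i,j)\mapsto\phi(i+k_1,j)$ and $\phi(i,j)\mapsto\phi(i,j+k_2)$. Let $V_1,V_2:\mathbf Z^2\to\mathbf C$ be bounded potentials such that, for some finite $a_1,a_2$, $V_1$ is supported in $\mathbf Z\times[-a_2,a_2]$ and $V_2$ is supported in $[-a_1,a_1]\times\mathbf Z$. Write $V_r$ also for the operator of multiplication by $V_r$, and let $H=A+V_1+V_2$. Theorem. $\mathcal J_1$ and $\mathcal J_2$ are contained in $\mathcal A$ (so they are ideals of $\mathcal A$) and $\mathcal J_1\cap\mathcal J_2=\mathcal K(\mathcal H)$. The operators $H$, $A+V_1$ and $A+V_2$ belong to $\mathcal A$, and $$\sigma_{\rm ess}(H)=\sigma_1(A+V_1)\cup\sigma_2(A+V_2).$$ If $V_1$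 is periodic in the $x_1$ direction and $V_2$ is periodic in the $x_2$ direction (with some periods $\ge1$), then $$\sigma_{\rm ess}(H)=\sigma(A+V_1)\cup\sigma(A+V_2).$$ -/

import Mathlib

open scoped ENNReal

noncomputable section

namespace CrossSpectrum

/-! ### The ideal of an increasing sequence of projections and its multiplier algebra -/

section Abstract

variable {E : Type*} [NormedAddCommGroup E] [InnerProductSpace ℂ E] [CompleteSpace E]

/-- An increasing sequence of orthogonal projections on a Hilbert space. -/
structure ProjSeq (E : Type*) [NormedAddCommGroup E] [InnerProductSpace ℂ E] [CompleteSpace E] where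
  /-- the projections -/
  p : ℕ → E →L[ℂ] E
  isStarProjection : ∀ n, IsStarProjection (p n)
  mul_eq_left : ∀ {m n}, m ≤ n → p m * p n = p m
  mul_eq_right : ∀ {m n}, m ≤ n → p n * p m = p m

variable (P : ProjSeq E)

lemma ProjSeq.left_mono {m n : ℕ} (h : m ≤ n) {x : E →L[ℂ] E} (hx : P.p m * x = x) :
    P.p n * x = x := by
  rw [← hx, ← mul_assoc, P.mul_eq_right h]

lemma ProjSeq.right_mono {m n : ℕ} (h : m ≤ n) {x : E →L[ℂ] E} (hx : x * P.p m = x) :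
    x * P.p n = x := by
  rw [← hx, mul_assoc, P.mul_eq_left h]

/-- The `*`-algebra of all `x` with `pₙ x = x pₙ = x` for some `n`. -/
def ProjSeq.J₀ : NonUnitalStarSubalgebra ℂ (E →L[ℂ] E) where
  carrier := {x | ∃ n, P.p n * x = x ∧ x * P.p n = x}
  zero_mem' := ⟨0, by simp⟩
  add_mem' := by
    rintro x y ⟨m, hx, hx'⟩ ⟨n, hy, hy'⟩
    refine ⟨max m n, ?_, ?_⟩
    · rw [mul_add, P.left_mono (le_max_left m n) hx, P.left_mono (le_max_right m n) hy]
    · rw [add_mul, P.right_mono (le_max_left m n) hx', P.right_mono (le_max_right m n) hy']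
  mul_mem' := by
    rintro x y ⟨m, hx, hx'⟩ ⟨n, hy, hy'⟩
    refine ⟨max m n, ?_, ?_⟩
    · rw [← mul_assoc, P.left_mono (le_max_left m n) hx]
    · rw [mul_assoc, P.right_mono (le_max_right m n) hy']
  smul_mem' := by
    rintro c x ⟨m, hx, hx'⟩
    exact ⟨m, by rw [mul_smul_comm, hx], by rw [smul_mul_assoc, hx']⟩
  star_mem' := by
    rintro x ⟨m, hx, hx'⟩
    have hs : star (P.p m) = P.p m := (P.isStarProjection m).isSelfAdjoint
    refine ⟨m, ?_, ?_⟩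
    · conv_rhs => rw [← hx', star_mul, hs]
    · conv_rhs => rw [← hx, star_mul, hs]

/-- The norm closure `𝒥` of `𝒥₀`. -/
def ProjSeq.J : NonUnitalStarSubalgebra ℂ (E →L[ℂ] E) := P.J₀.topologicalClosure

/-- The algebra `{a | a 𝒥 ⊆ 𝒥 and 𝒥 a ⊆ 𝒥}`. -/
def multiplier (J : NonUnitalStarSubalgebra ℂ (E →L[ℂ] E)) : StarSubalgebra ℂ (E →L[ℂ] E) where
  carrier := {a | (∀ x ∈ J, a * x ∈ J) ∧ (∀ x ∈ J, x * a ∈ J)}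
  mul_mem' := by
    rintro a b ⟨ha, ha'⟩ ⟨hb, hb'⟩
    refine ⟨fun x hx => ?_, fun x hx => ?_⟩
    · rw [mul_assoc]; exact ha _ (hb _ hx)
    · rw [← mul_assoc]; exact hb' _ (ha' _ hx)
  add_mem' := by
    rintro a b ⟨ha, ha'⟩ ⟨hb, hb'⟩
    refine ⟨fun x hx => ?_, fun x hx => ?_⟩
    · rw [add_mul]; exact add_mem (ha _ hx) (hb _ hx)
    · rw [mul_add]; exact add_mem (ha' _ hx) (hb' _ hx)
  algebraMap_mem' := by
    intro c
    refine ⟨fun x hx => ?_, fun x hx => ?_⟩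
    · rw [Algebra.algebraMap_eq_smul_one, smul_mul_assoc, one_mul]
      exact SMulMemClass.smul_mem c hx
    · rw [Algebra.algebraMap_eq_smul_one, mul_smul_comm, mul_one]
      exact SMulMemClass.smul_mem c hx
  star_mem' := by
    rintro a ⟨ha, ha'⟩
    refine ⟨fun x hx => ?_, fun x hx => ?_⟩
    · simpa using star_mem (ha' _ (star_mem hx))
    · simpa using star_mem (ha _ (star_mem hx))

/-- `𝒥`, viewed as a subset of a `*`-algebra `S` of multipliers of `𝒥`, is a two-sided ideal
of `S`. -/
def idealIn (S : StarSubalgebra ℂ (E →L[ℂ] E)) (J : NonUnitalStarSubalgebra ℂ (E →L[ℂ] E)) (hS : S ≤ multiplier J) :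
    Ideal S where
  carrier := {a | (a : E →L[ℂ] E) ∈ J}
  add_mem' := fun ha hb => add_mem (S := NonUnitalStarSubalgebra ℂ (E →L[ℂ] E)) ha hb
  zero_mem' := zero_mem J
  smul_mem' := fun a _ hx => (hS a.2).1 _ hx

instance (S : StarSubalgebra ℂ (E →L[ℂ] E)) (J : NonUnitalStarSubalgebra ℂ (E →L[ℂ] E)) (hS : S ≤ multiplier J) :
    (idealIn S J hS).IsTwoSided where
  mul_mem_of_left := fun b ha => (hS b.2).2 _ ha

end Abstract

/-! ### The essential spectrum, defined by means of the Calkin algebra -/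

section Calkin

variable (E : Type*) [NormedAddCommGroup E] [InnerProductSpace ℂ E] [CompleteSpace E]

/-- The ideal of compact operators in the algebra of bounded operators. -/
def compactIdeal : Ideal (E →L[ℂ] E) where
  carrier := {T | IsCompactOperator T}
  add_mem' := fun hS hT => hS.add hT
  zero_mem' := isCompactOperator_zero
  smul_mem' := fun S _ hT => hT.clm_comp S

instance : (compactIdeal E).IsTwoSided where
  mul_mem_of_left := fun S hT => IsCompactOperator.comp_clm hT S

variable {E}

/-- The essential spectrum of `T`: the spectrum of its image in the Calkin algebra. -/
def essSpectrum (T : E →L[ℂ] E) : Set ℂ :=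
  spectrum ℂ (Ideal.Quotient.mk (compactIdeal E) T)

end Calkin

/-! ### Operators on `l²(ℤ²)` -/

/-- The Hilbert space `l²(ℤ²)`. -/
def Hil : Type := lp (fun _ : ℤ × ℤ => ℂ) 2

namespace Hil

instance : NormedAddCommGroup Hil :=
  inferInstanceAs (NormedAddCommGroup (lp (fun _ : ℤ × ℤ => ℂ) 2))

instance : InnerProductSpace ℂ Hil :=
  inferInstanceAs (InnerProductSpace ℂ (lp (fun _ : ℤ × ℤ => ℂ) 2))

instance : CompleteSpace Hil :=
  inferInstanceAs (CompleteSpace (lp (fun _ : ℤ × ℤ => ℂ) 2))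

/-- The value `φ(x)`. -/
def val (φ : Hil) (x : ℤ × ℤ) : ℂ := (show lp (fun _ : ℤ × ℤ => ℂ) 2 from φ) x

instance : CoeFun Hil fun _ => ℤ × ℤ → ℂ := ⟨val⟩

/-- A square-summable function as a vector of `l²(ℤ²)`. -/
def mk (f : ℤ × ℤ → ℂ) (hf : Memℓp f 2) : Hil := (⟨f, hf⟩ : lp (fun _ : ℤ × ℤ => ℂ) 2)

@[simp] lemma mk_apply (f : ℤ × ℤ → ℂ) (hf : Memℓp f 2) (x : ℤ × ℤ) : mk f hf x = f x := rfl

lemma memℓp (φ : Hil) : Memℓp (φ : ℤ × ℤ → ℂ) 2 := lp.memℓp (show lp (fun _ => ℂ) 2 from φ)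

@[ext] lemma ext {φ ψ : Hil} (h : ∀ x, φ x = ψ x) : φ = ψ := lp.ext (funext h)

@[simp] lemma add_apply (φ ψ : Hil) (x : ℤ × ℤ) : (φ + ψ) x = φ x + ψ x := rfl

@[simp] lemma zero_apply (x : ℤ × ℤ) : (0 : Hil) x = 0 := rfl

@[simp] lemma smul_apply (c : ℂ) (φ : Hil) (x : ℤ × ℤ) : (c • φ) x = c * φ x := rfl

lemma sum_apply {ι : Type*} (s : Finset ι) (φ : ι → Hil) (x : ℤ × ℤ) :
    (∑ r ∈ s, φ r) x = ∑ r ∈ s, φ r x :=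
  map_sum (⟨⟨fun ψ : Hil => ψ x, zero_apply x⟩, fun φ ψ => add_apply φ ψ x⟩ : Hil →+ ℂ) φ s

lemma inner_eq_tsum (φ ψ : Hil) : inner ℂ φ ψ = ∑' x, inner ℂ (φ x) (ψ x) :=
  lp.inner_eq_tsum (𝕜 := ℂ) (show lp (fun _ => ℂ) 2 from φ) ψ

lemma norm_sq_eq_tsum (φ : Hil) : ‖φ‖ ^ 2 = ∑' x, ‖φ x‖ ^ 2 := by
  have h := lp.norm_rpow_eq_tsum (p := 2) (by norm_num) (show lp (fun _ : ℤ × ℤ => ℂ) 2 from φ)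
  simp only [ENNReal.toReal_ofNat, Real.rpow_ofNat] at h
  exact h

lemma summable_norm_sq (φ : Hil) : Summable fun x => ‖φ x‖ ^ 2 := by
  simpa using φ.memℓp.summable (by norm_num)

end Hil

/-- Bounded complex functions on `ℤ²`. -/
abbrev BddFun : Type := lp (fun _ : ℤ × ℤ => ℂ) ∞

lemma BddFun.norm_mul_le (a : BddFun) (x : ℤ × ℤ) (z : ℂ) : ‖a x * z‖ ≤ ‖a‖ * ‖z‖ := by
  rw [norm_mul]
  gcongr
  exact lp.norm_apply_le_norm ENNReal.top_ne_zero a x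

lemma BddFun.summable_mul (a : BddFun) (φ : Hil) : Summable fun x => ‖a x * φ x‖ ^ 2 := by
  refine Summable.of_nonneg_of_le (fun _ => by positivity) (fun x => ?_)
    (φ.summable_norm_sq.mul_left (‖a‖ ^ 2))
  rw [← mul_pow]
  gcongr
  exact a.norm_mul_le x (φ x)

/-- The operator of multiplication by a bounded function. -/
def mulOp (a : BddFun) : Hil →L[ℂ] Hil :=
  LinearMap.mkContinuous
    { toFun := fun φ => Hil.mk (fun x => a x * φ x)
        (memℓp_gen (by simpa using BddFun.summable_mul a φ))
      map_add' := fun φ ψ => by ext x; simp [mul_add]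
      map_smul' := fun c φ => by ext x; simp [mul_left_comm] }
    ‖a‖ fun φ => by
      refine (sq_le_sq₀ (norm_nonneg _) (by positivity)).1 ?_
      rw [mul_pow, Hil.norm_sq_eq_tsum, Hil.norm_sq_eq_tsum, ← tsum_mul_left]
      refine Summable.tsum_le_tsum (fun x => ?_) (BddFun.summable_mul a φ)
        (φ.summable_norm_sq.mul_left _)
      rw [← mul_pow]
      exact pow_le_pow_left₀ (norm_nonneg _) (BddFun.norm_mul_le a x (φ x)) 2

@[simp] lemma mulOp_apply (a : BddFun) (φ : Hil) (x : ℤ × ℤ) : mulOp a φ x = a x * φ x := rfl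

/-- The translation `(T_b φ)(x) = φ(x + b)`. -/
def translation (b : ℤ × ℤ) : Hil →L[ℂ] Hil :=
  LinearMap.mkContinuous
    { toFun := fun φ => Hil.mk (fun x => φ (x + b))
        (memℓp_gen ((φ.memℓp.summable (by norm_num)).comp_injective (add_left_injective b)))
      map_add' := fun _ _ => rfl
      map_smul' := fun _ _ => rfl }
    1 fun φ => by
      refine (sq_le_sq₀ (norm_nonneg _) (by positivity)).1 ?_
      rw [one_mul, Hil.norm_sq_eq_tsum, Hil.norm_sq_eq_tsum]
      exact le_of_eq ((Equiv.addRight b).tsum_eq fun x => ‖φ x‖ ^ 2)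

@[simp] lemma translation_apply (b : ℤ × ℤ) (φ : Hil) (x : ℤ × ℤ) :
    translation b φ x = φ (x + b) := rfl

/-- The discrete Schrödinger operator `(A φ)(x) = ∑ᵣ cᵣ(x) φ(x + bᵣ)`. -/
def schrodinger {m : ℕ} (c : Fin m → BddFun) (b : Fin m → ℤ × ℤ) : Hil →L[ℂ] Hil :=
  ∑ r, mulOp (c r) * translation (b r)

lemma schrodinger_apply {m : ℕ} (c : Fin m → BddFun) (b : Fin m → ℤ × ℤ) (φ : Hil) (x : ℤ × ℤ) :
    schrodinger c b φ x = ∑ r, c r x * φ (x + b r) := by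
  simp only [schrodinger, _root_.sum_apply, Hil.sum_apply, mul_apply_eq_comp, mulOp_apply,
    translation_apply]

/-- The operator `T` is periodic in the direction `e`, with some period `k ≥ 1`. -/
def IsPeriodicOp (e : ℤ × ℤ) (T : Hil →L[ℂ] Hil) : Prop :=
  ∃ k : ℕ, 0 < k ∧ translation (k • e) * T = T * translation (k • e)

/-- The potential `V` is periodic in the direction `e`, with some period `k ≥ 1`. -/
def IsPeriodicFun (e : ℤ × ℤ) (V : BddFun) : Prop :=
  ∃ k : ℕ, 0 < k ∧ ∀ x, V (x + k • e) = V x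

/-! ### The two strip ideals -/

/-- The indicator function of `{x | |f x| ≤ n}`. -/
def stripIndicator (f : ℤ × ℤ → ℤ) (n : ℕ) : BddFun :=
  ⟨fun x => if |f x| ≤ n then 1 else 0, memℓp_infty ⟨1, by
    rintro _ ⟨x, rfl⟩
    dsimp only
    split_ifs <;> simp⟩⟩

lemma stripIndicator_apply (f : ℤ × ℤ → ℤ) (n : ℕ) (x : ℤ × ℤ) :
    stripIndicator f n x = if |f x| ≤ n then 1 else 0 := rfl

/-- The projections `(pₙ φ)(x) = φ(x)` if `-n ≤ f x ≤ n`, and `0` otherwise. -/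
def stripProj (f : ℤ × ℤ → ℤ) : ProjSeq Hil where
  p n := mulOp (stripIndicator f n)
  isStarProjection n := by
    refine ⟨?_, ?_⟩
    · ext φ x
      simp only [mul_apply_eq_comp, mulOp_apply, stripIndicator_apply]
      split_ifs <;> simp
    · rw [ContinuousLinearMap.isSelfAdjoint_iff_isSymmetric]
      intro φ ψ
      simp only [ContinuousLinearMap.coe_coe, Hil.inner_eq_tsum, mulOp_apply, stripIndicator_apply]
      refine tsum_congr fun x => ?_
      split_ifs <;> simp
  mul_eq_left {m n} h := by
    ext φ x
    have h' : |f x| ≤ (m : ℤ) → |f x| ≤ (n : ℤ) := fun h1 => h1.trans (by exact_mod_cast h)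
    simp only [mul_apply_eq_comp, mulOp_apply, stripIndicator_apply]
    split_ifs <;> simp_all
  mul_eq_right {m n} h := by
    ext φ x
    have h' : |f x| ≤ (m : ℤ) → |f x| ≤ (n : ℤ) := fun h1 => h1.trans (by exact_mod_cast h)
    simp only [mul_apply_eq_comp, mulOp_apply, stripIndicator_apply]
    split_ifs <;> simp_all

/-- The ideal `𝒥₁` of the vertical strips `[-n, n] × ℤ`. -/
def J₁ : NonUnitalStarSubalgebra ℂ (Hil →L[ℂ] Hil) := (stripProj Prod.fst).J

/-- The ideal `𝒥₂` of the horizontal strips `ℤ × [-n, n]`. -/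
def J₂ : NonUnitalStarSubalgebra ℂ (Hil →L[ℂ] Hil) := (stripProj Prod.snd).J

/-- The C*-algebra `𝒜` of all bounded `x` with `x 𝒥ᵢ ⊆ 𝒥ᵢ` and `𝒥ᵢ x ⊆ 𝒥ᵢ` for `i = 1, 2`. -/
def 𝒜 : StarSubalgebra ℂ (Hil →L[ℂ] Hil) := multiplier J₁ ⊓ multiplier J₂

lemma 𝒜_le₁ : 𝒜 ≤ multiplier J₁ := inf_le_left

lemma 𝒜_le₂ : 𝒜 ≤ multiplier J₂ := inf_le_right

/-- `σ₁(x)`: the spectrum of the image of `x` in `𝒜 / 𝒥₁`. -/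
def σ₁ (x : 𝒜) : Set ℂ := spectrum ℂ (Ideal.Quotient.mk (idealIn 𝒜 J₁ 𝒜_le₁) x)

/-- `σ₂(x)`: the spectrum of the image of `x` in `𝒜 / 𝒥₂`. -/
def σ₂ (x : 𝒜) : Set ℂ := spectrum ℂ (Ideal.Quotient.mk (idealIn 𝒜 J₂ 𝒜_le₂) x)

end CrossSpectrum

end

noncomputable section

namespace CrossSpectrum

open Filter Topology

/-! ### Approximate units and multipliers for a sequence of projections. -/

section Abstract

variable {E : Type*} [NormedAddCommGroup E] [InnerProductSpace ℂ E] [CompleteSpace E]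

namespace ProjSeq

variable (P : ProjSeq E)

/-! A vertical and a horizontal strip meet in a finite box, so products of `J₁` with `J₂` are
compact; conversely compact operators lie in both ideals. Hence invertibility modulo compacts should
be the same as invertibility modulo both ideals (`mem_essSpectrum_iff`). Two one-sided inverses
`y₁`, `y₂` of `x` modulo `J₁`, `J₂` combine into `y₁ + y₂ - y₁ x y₂`, whose error is the product of
the two errors. In the other direction an inverse modulo compacts has to be moved into `𝒜`; this is
C*-algebraic spectral permanence (`exists_left_parametrix`). Since `V₂` lies in `J₁` and `V₁` in
`J₂`, each quotient forgets one potential.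

In the periodic case a translation transversal to the strips commutes with the operator and carries
every vector out of every strip, where elements of the ideal have no effect
(`tendsto_mul_translation`). An inverse modulo the ideal then gives a lower bound on all vectors,
for the operator and its adjoint, so the operator is invertible (`isUnit_of_commute`). -/

lemma norm_p_le (n : ℕ) : ‖P.p n‖ ≤ 1 := (P.isStarProjection n).norm_le

lemma star_p (n : ℕ) : star (P.p n) = P.p n := (P.isStarProjection n).isSelfAdjoint

lemma isClosed_J : IsClosed (P.J : Set (E →L[ℂ] E)) :=
  NonUnitalStarSubalgebra.isClosed_topologicalClosure _

lemma J₀_le_J : P.J₀ ≤ P.J := NonUnitalStarSubalgebra.le_topologicalClosure _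

lemma mem_J₀ {x : E →L[ℂ] E} : x ∈ P.J₀ ↔ ∃ n, P.p n * x = x ∧ x * P.p n = x := Iff.rfl

lemma p_mul_mul_p_mem_J (n : ℕ) (x : E →L[ℂ] E) : P.p n * x * P.p n ∈ P.J := by
  have h := (P.isStarProjection n).isIdempotentElem
  refine P.J₀_le_J (P.mem_J₀.2 ⟨n, ?_, ?_⟩)
  · rw [← mul_assoc, ← mul_assoc, h]
  · rw [mul_assoc, h]

variable {P}

/-- On `J₀` the sequence is eventually constant, and `‖P.p n‖ ≤ 1` carries the limit over to the
closure. -/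
lemma tendsto_p_mul {x : E →L[ℂ] E} (hx : x ∈ P.J) :
    Tendsto (fun n => P.p n * x) atTop (𝓝 x) := by
  rw [Metric.tendsto_atTop]
  intro ε hε
  obtain ⟨y, ⟨N, hy, -⟩, hxy⟩ := Metric.mem_closure_iff.1 hx (ε / 2) (half_pos hε)
  refine ⟨N, fun n hn => ?_⟩
  have h : P.p n * x - x = P.p n * (x - y) - (x - y) := by
    rw [mul_sub, P.left_mono hn hy]; abel
  rw [dist_eq_norm] at hxy ⊢
  rw [h]
  calc ‖P.p n * (x - y) - (x - y)‖ ≤ ‖P.p n‖ * ‖x - y‖ + ‖x - y‖ :=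
        (norm_sub_le _ _).trans (by gcongr; exact norm_mul_le _ _)
    _ ≤ 1 * ‖x - y‖ + ‖x - y‖ := by gcongr; exact P.norm_p_le n
    _ < ε := by linarith

lemma tendsto_mul_p_iff {x : E →L[ℂ] E} :
    Tendsto (fun n => x * P.p n) atTop (𝓝 x) ↔
      Tendsto (fun n => P.p n * star x) atTop (𝓝 (star x)) := by
  refine ⟨fun h => ?_, fun h => ?_⟩
  · simpa [star_mul, P.star_p] using h.star
  · simpa [star_mul, P.star_p] using h.star

lemma tendsto_mul_p {x : E →L[ℂ] E} (hx : x ∈ P.J) :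
    Tendsto (fun n => x * P.p n) atTop (𝓝 x) :=
  tendsto_mul_p_iff.2 (tendsto_p_mul (star_mem hx))

lemma mem_J_of_tendsto {x : E →L[ℂ] E} (h₁ : Tendsto (fun n => P.p n * x) atTop (𝓝 x))
    (h₂ : Tendsto (fun n => x * P.p n) atTop (𝓝 x)) : x ∈ P.J := by
  refine P.isClosed_J.mem_of_tendsto (f := fun n => P.p n * x * P.p n) (b := atTop) ?_
    (Eventually.of_forall fun n => P.p_mul_mul_p_mem_J n x)
  have h : Tendsto (fun n => P.p n * (x * P.p n - x)) atTop (𝓝 0) := by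
    refine squeeze_zero_norm (fun n => ?_) (tendsto_iff_norm_sub_tendsto_zero.1 h₂)
    exact (norm_mul_le _ _).trans (mul_le_of_le_one_left (norm_nonneg _) (P.norm_p_le n))
  simpa [mul_sub, mul_assoc] using h.add h₁

lemma mem_multiplier {a : E →L[ℂ] E} (h₁ : ∀ n, ∃ m, P.p m * (a * P.p n) = a * P.p n)
    (h₂ : ∀ n, ∃ m, P.p n * a * P.p m = P.p n * a) : a ∈ multiplier P.J := by
  refine ⟨fun x hx => ?_, fun x hx => ?_⟩
  · refine map_mem_closure (f := (a * ·)) (by fun_prop) hx ?_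
    rintro y ⟨n, hy, hy'⟩
    obtain ⟨m, hm⟩ := h₁ n
    have hm' : P.p m * (a * y) = a * y := by
      conv_lhs => rw [← hy, ← mul_assoc a, ← mul_assoc, hm]
      rw [mul_assoc, hy]
    have hn' : a * y * P.p n = a * y := by rw [mul_assoc, hy']
    exact ⟨max m n, P.left_mono (le_max_left _ _) hm', P.right_mono (le_max_right _ _) hn'⟩
  · refine map_mem_closure (f := (· * a)) (by fun_prop) hx ?_
    rintro y ⟨n, hy, hy'⟩
    obtain ⟨m, hm⟩ := h₂ n
    have hm' : y * a * P.p m = y * a := by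
      conv_lhs => rw [← hy', mul_assoc y, mul_assoc, hm]
      rw [← mul_assoc, hy']
    have hn' : P.p n * (y * a) = y * a := by rw [← mul_assoc, hy]
    exact ⟨max m n, P.left_mono (le_max_right _ _) hn', P.right_mono (le_max_left _ _) hm'⟩

lemma J_le_multiplier {x : E →L[ℂ] E} (hx : x ∈ P.J) : x ∈ multiplier P.J :=
  ⟨fun _ hy => mul_mem hx hy, fun _ hy => mul_mem hy hx⟩

lemma isClosed_multiplier_J : IsClosed (multiplier P.J : Set (E →L[ℂ] E)) := by
  have h : (multiplier P.J : Set (E →L[ℂ] E)) =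
      (⋂ x ∈ P.J, (· * x) ⁻¹' (P.J : Set (E →L[ℂ] E))) ∩
        ⋂ x ∈ P.J, (x * ·) ⁻¹' (P.J : Set (E →L[ℂ] E)) := by
    ext a
    simp only [Set.mem_inter_iff, Set.mem_iInter, Set.mem_preimage, SetLike.mem_coe]
    rfl
  rw [h]
  exact (isClosed_biInter fun x _ => P.isClosed_J.preimage (by fun_prop)).inter
    (isClosed_biInter fun x _ => P.isClosed_J.preimage (by fun_prop))

/-- On a compact operator, strong convergence of contractions to the identity becomes norm
convergence. -/
lemma tendsto_p_mul_of_isCompactOperator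
    (hP : ∀ φ : E, Tendsto (fun n => P.p n φ) atTop (𝓝 φ)) {T : E →L[ℂ] E}
    (hT : IsCompactOperator T) : Tendsto (fun n => P.p n * T) atTop (𝓝 T) := by
  rw [Metric.tendsto_atTop]
  intro ε hε
  obtain ⟨K, hK, hTK⟩ := IsCompactOperator.image_closedBall_subset_compact
    (f := (T : E →ₗ[ℂ] E)) hT 1
  -- Three errors below `ε / 6` add up to `ε / 2`, which leaves room for the supremum over unit
  -- vectors.
  obtain ⟨t, ht, htK⟩ := Metric.totallyBounded_iff.1 hK.totallyBounded (ε / 6) (by positivity)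
  have hev : ∀ᶠ n in atTop, ∀ y ∈ t, dist (P.p n y) y < ε / 6 :=
    (eventually_all_finite ht).2 fun y _ =>
      (hP y).eventually (Metric.ball_mem_nhds y (by positivity))
  obtain ⟨N, hN⟩ := eventually_atTop.1 hev
  refine ⟨N, fun n hn => ?_⟩
  rw [dist_eq_norm]
  refine (ContinuousLinearMap.opNorm_le_of_unit_norm (C := ε / 2) (by positivity)
    fun φ hφ => ?_).trans_lt (half_lt_self hε)
  have hφK : T φ ∈ K := hTK ⟨φ, by simp [hφ], rfl⟩
  obtain ⟨y, hy, hyφ⟩ := Set.mem_iUnion₂.1 (htK hφK)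
  have h1 : ‖T φ - y‖ < ε / 6 := by rw [← dist_eq_norm]; exact hyφ
  have h2 : ‖P.p n y - y‖ < ε / 6 := by rw [← dist_eq_norm]; exact hN n hn y hy
  have h3 : ‖P.p n (T φ - y)‖ ≤ ‖T φ - y‖ :=
    ((P.p n).le_opNorm _).trans (mul_le_of_le_one_left (norm_nonneg _) (P.norm_p_le n))
  have h4 : (P.p n * T - T) φ = P.p n (T φ - y) + (P.p n y - y) - (T φ - y) := by
    simp [map_sub]
  rw [h4]
  have := norm_sub_le (P.p n (T φ - y) + (P.p n y - y)) (T φ - y)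
  have := norm_add_le (P.p n (T φ - y)) (P.p n y - y)
  linarith

end ProjSeq

/-! ### Invertibility and parametrices -/

/-- The quadratic form is `‖x φ‖² + ‖k φ‖²`, and by Cauchy–Schwarz the hypothesis makes it coercive.
-/
lemma isUnit_star_mul_self_add {x k : E →L[ℂ] E} {C : ℝ}
    (h : ∀ φ, ‖φ‖ ≤ C * ‖x φ‖ + ‖k φ‖) : IsUnit (star x * x + star k * k) := by
  have hD : (0 : ℝ) < 2 * (C ^ 2 + 1) := by positivity
  refine ContinuousLinearMap.isUnit_of_forall_le_norm_inner_map _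
    (c := ⟨(2 * (C ^ 2 + 1))⁻¹, by positivity⟩) (NNReal.coe_pos.1 (inv_pos.2 hD))
    fun φ => ?_
  have h1 : inner ℂ ((star x * x + star k * k) φ) φ = ((‖x φ‖ ^ 2 + ‖k φ‖ ^ 2 : ℝ) : ℂ) := by
    simp [ContinuousLinearMap.star_eq_adjoint,
      ContinuousLinearMap.adjoint_inner_left, inner_self_eq_norm_sq_to_K]
  rw [h1, Complex.norm_real, Real.norm_of_nonneg (by positivity)]
  change ‖φ‖ ^ 2 * (2 * (C ^ 2 + 1))⁻¹ ≤ _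
  rw [← div_eq_mul_inv, div_le_iff₀ hD]
  have h2 : ‖φ‖ ^ 2 ≤ (C * ‖x φ‖ + ‖k φ‖) ^ 2 := pow_le_pow_left₀ (norm_nonneg _) (h φ) 2
  nlinarith [sq_nonneg (C * ‖x φ‖ - ‖k φ‖), sq_nonneg (C * ‖k φ‖), sq_nonneg (‖x φ‖)]

lemma isUnit_of_bounded_below {x : E →L[ℂ] E} {C D : ℝ}
    (h : ∀ φ, ‖φ‖ ≤ C * ‖x φ‖) (h' : ∀ φ, ‖φ‖ ≤ D * ‖star x φ‖) : IsUnit x := by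
  have h1 : IsUnit (star x * x) := by
    simpa using isUnit_star_mul_self_add (x := x) (k := 0) (by simpa using h)
  have h2 : IsUnit (x * star x) := by
    simpa using isUnit_star_mul_self_add (x := star x) (k := 0) (by simpa using h')
  obtain ⟨u, hu⟩ := h1
  obtain ⟨v, hv⟩ := h2
  have hl : (↑u⁻¹ * star x) * x = 1 := by rw [mul_assoc, ← hu, Units.inv_mul]
  have hr : x * (star x * ↑v⁻¹) = 1 := by rw [← mul_assoc, ← hv, Units.mul_inv]
  exact ⟨⟨x, _, left_inv_eq_right_inv hl hr ▸ hr, hl⟩, rfl⟩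

/-- A left parametrix of `x` modulo compact operators can be chosen in any closed `*`-subalgebra
that contains `x` and the compact operators. -/
lemma exists_left_parametrix (S : StarSubalgebra ℂ (E →L[ℂ] E))
    (hS : IsClosed (S : Set (E →L[ℂ] E))) (hK : ∀ k : E →L[ℂ] E, IsCompactOperator k → k ∈ S)
    {x : E →L[ℂ] E} (hx : x ∈ S) {y : E →L[ℂ] E} (h : IsCompactOperator (1 - y * x : E →L[ℂ] E)) :
    ∃ z ∈ S, IsCompactOperator (1 - z * x : E →L[ℂ] E) := by
  set k := 1 - y * x with hk
  have hkk : IsCompactOperator (star k * k : E →L[ℂ] E) := IsCompactOperator.clm_comp h (star k)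
  -- `y x + k = 1` bounds `x` and `k` jointly from below. Unlike `y`, this operator belongs to `S`.
  have hu : IsUnit (star x * x + star k * k) := by
    refine isUnit_star_mul_self_add (C := ‖y‖) fun φ => ?_
    have hφ : φ = y (x φ) + k φ := by simp [hk]
    calc ‖φ‖ = ‖y (x φ) + k φ‖ := by rw [← hφ]
      _ ≤ ‖y (x φ)‖ + ‖k φ‖ := norm_add_le _ _
      _ ≤ ‖y‖ * ‖x φ‖ + ‖k φ‖ := by gcongr; exact y.le_opNorm _
  have hbS : star x * x + star k * k ∈ S := add_mem (mul_mem (star_mem hx) hx) (hK _ hkk)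
  -- Spectral permanence: the inverse of an element of a closed `*`-subalgebra stays in it.
  have := hS
  obtain ⟨u, hu'⟩ := (S.coe_isUnit (a := ⟨_, hbS⟩)).1 hu
  have hinv : ((u⁻¹ : Sˣ) : S) * (star x * x + star k * k) = (1 : E →L[ℂ] E) := by
    have := congrArg (Subtype.val) (u.inv_mul)
    rwa [hu'] at this
  refine ⟨((u⁻¹ : Sˣ) : S) * star x, mul_mem (SetLike.coe_mem _) (star_mem hx), ?_⟩
  have h1 : 1 - ((u⁻¹ : Sˣ) : S) * star x * x = ((u⁻¹ : Sˣ) : S) * (star k * k) := by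
    rw [← hinv]; noncomm_ring
  rw [h1]
  exact IsCompactOperator.clm_comp hkk _

end Abstract

lemma isUnit_quotient_mk_iff {R : Type*} [Ring R] (I : Ideal R) [I.IsTwoSided] (x : R) :
    IsUnit (Ideal.Quotient.mk I x) ↔ (∃ y, 1 - y * x ∈ I) ∧ ∃ y, 1 - x * y ∈ I := by
  constructor
  · rintro ⟨u, hu⟩
    obtain ⟨y, hy⟩ := Ideal.Quotient.mk_surjective (↑u⁻¹ : R ⧸ I)
    refine ⟨⟨y, ?_⟩, ⟨y, ?_⟩⟩
    · rw [← Ideal.Quotient.eq_zero_iff_mem, map_sub, map_mul, hy, ← hu, map_one, Units.inv_mul,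
        sub_self]
    · rw [← Ideal.Quotient.eq_zero_iff_mem, map_sub, map_mul, hy, ← hu, map_one, Units.mul_inv,
        sub_self]
  · rintro ⟨⟨y, hy⟩, ⟨z, hz⟩⟩
    rw [← Ideal.Quotient.eq_zero_iff_mem, map_sub, map_mul, map_one, sub_eq_zero] at hy hz
    exact ⟨⟨_, _, left_inv_eq_right_inv hy.symm hz.symm ▸ hz.symm, hy.symm⟩, rfl⟩

/-! ### Strips in `l²(ℤ²)` -/

lemma Hil.sub_apply (φ ψ : Hil) (x : ℤ × ℤ) : (φ - ψ) x = φ x - ψ x := rfl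

lemma Hil.tendsto_zero_of_dominated {ψ : ℕ → Hil} (φ : Hil) (h : ∀ n x, ‖ψ n x‖ ≤ ‖φ x‖)
    (h₀ : ∀ x, ∀ᶠ n in atTop, ψ n x = 0) : Tendsto ψ atTop (𝓝 0) := by
  have h1 : Tendsto (fun n => ∑' x, ‖ψ n x‖ ^ 2) atTop (𝓝 (∑' _ : ℤ × ℤ, (0 : ℝ))) := by
    refine tendsto_tsum_of_dominated_convergence φ.summable_norm_sq (fun x => ?_)
      (Eventually.of_forall fun n x => ?_)
    · refine tendsto_const_nhds.congr' ?_
      filter_upwards [h₀ x] with n hn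
      simp [hn]
    · rw [Real.norm_of_nonneg (by positivity)]
      exact pow_le_pow_left₀ (norm_nonneg _) (h n x) 2
  rw [tendsto_zero_iff_norm_tendsto_zero]
  simp only [← Hil.norm_sq_eq_tsum, tsum_zero] at h1
  simpa using h1.sqrt

lemma stripProj_p_apply (f : ℤ × ℤ → ℤ) (n : ℕ) (φ : Hil) (x : ℤ × ℤ) :
    (stripProj f).p n φ x = if |f x| ≤ n then φ x else 0 := by
  change mulOp (stripIndicator f n) φ x = _
  simp [stripIndicator_apply]

lemma tendsto_stripProj_p (f : ℤ × ℤ → ℤ) (φ : Hil) :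
    Tendsto (fun n => (stripProj f).p n φ) atTop (𝓝 φ) := by
  rw [← tendsto_sub_nhds_zero_iff]
  refine Hil.tendsto_zero_of_dominated φ (fun n x => ?_) fun x => ?_
  · rw [Hil.sub_apply, stripProj_p_apply]
    split_ifs <;> simp
  · filter_upwards [eventually_ge_atTop (f x).natAbs] with n hn
    have : |f x| ≤ n := by rw [Int.abs_eq_natAbs]; exact_mod_cast hn
    rw [Hil.sub_apply, stripProj_p_apply, if_pos this, sub_self]

/-! ### Compact operators and the two strip ideals. -/

lemma isCompactOperator_of_support_finite {T : Hil →L[ℂ] Hil} (s : Finset (ℤ × ℤ))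
    (hT : ∀ φ, ∀ x ∉ s, T φ x = 0) : IsCompactOperator T := by
  let e : LinearMap.range (T : Hil →ₗ[ℂ] Hil) →ₗ[ℂ] (s → ℂ) :=
    { toFun := fun φ x => (φ : Hil) x
      map_add' := fun _ _ => rfl
      map_smul' := fun _ _ => rfl }
  have he : Function.Injective e := by
    rintro ⟨_, φ, rfl⟩ ⟨_, ψ, rfl⟩ h
    refine Subtype.ext (Hil.ext fun x => ?_)
    by_cases hx : x ∈ s
    · exact congrFun h ⟨x, hx⟩
    · exact (hT φ x hx).trans (hT ψ x hx).symm
  have : FiniteDimensional ℂ (LinearMap.range (T : Hil →ₗ[ℂ] Hil)) :=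
    FiniteDimensional.of_injective e he
  have : ProperSpace (LinearMap.range (T : Hil →ₗ[ℂ] Hil)) := FiniteDimensional.proper ℂ _
  let T' : Hil →L[ℂ] LinearMap.range (T : Hil →ₗ[ℂ] Hil) :=
    T.codRestrict _ fun φ => ⟨φ, rfl⟩
  exact (isCompactOperator_of_locallyCompactSpace_dom T').clm_comp
    (Submodule.subtypeL _)

lemma isCompactOperator_stripProj_mul (m n : ℕ) :
    IsCompactOperator ((stripProj Prod.fst).p m * (stripProj Prod.snd).p n : Hil →L[ℂ] Hil) := by
  refine isCompactOperator_of_support_finite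
    (Finset.Icc (-m : ℤ) m ×ˢ Finset.Icc (-n : ℤ) n) fun φ x hx => ?_
  rw [mul_apply_eq_comp, stripProj_p_apply, stripProj_p_apply]
  simp only [Finset.mem_product, Finset.mem_Icc, ← abs_le] at hx
  split_ifs <;> simp_all

lemma stripProj_commute (f g : ℤ × ℤ → ℤ) (m n : ℕ) :
    (stripProj f).p m * (stripProj g).p n = (stripProj g).p n * (stripProj f).p m := by
  ext φ x
  simp only [mul_apply_eq_comp, stripProj_p_apply]
  split_ifs <;> rfl

lemma _root_.IsCompactOperator.mul_left {T : Hil →L[ℂ] Hil} (hT : IsCompactOperator T)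
    (S : Hil →L[ℂ] Hil) : IsCompactOperator (S * T : Hil →L[ℂ] Hil) := hT.clm_comp S

lemma _root_.IsCompactOperator.mul_right {T : Hil →L[ℂ] Hil} (hT : IsCompactOperator T)
    (S : Hil →L[ℂ] Hil) : IsCompactOperator (T * S : Hil →L[ℂ] Hil) := hT.comp_clm S

lemma isCompactOperator_mul_of_mem {x y : Hil →L[ℂ] Hil} (hx : x ∈ J₁) (hy : y ∈ J₂) :
    IsCompactOperator (x * y : Hil →L[ℂ] Hil) := by
  refine isCompactOperator_of_tendsto ((ProjSeq.tendsto_mul_p hx).mul (ProjSeq.tendsto_p_mul hy))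
    (Eventually.of_forall fun n => ?_)
  have := ((isCompactOperator_stripProj_mul n n).mul_right y).mul_left x
  simpa only [mul_assoc] using this

lemma isCompactOperator_mul_of_mem' {x y : Hil →L[ℂ] Hil} (hx : x ∈ J₁) (hy : y ∈ J₂) :
    IsCompactOperator (y * x : Hil →L[ℂ] Hil) := by
  refine isCompactOperator_of_tendsto ((ProjSeq.tendsto_mul_p hy).mul (ProjSeq.tendsto_p_mul hx))
    (Eventually.of_forall fun n => ?_)
  have := ((isCompactOperator_stripProj_mul n n).mul_right x).mul_left y
  rw [stripProj_commute] at this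
  simpa only [mul_assoc] using this

lemma isCompactOperator_of_mem {x : Hil →L[ℂ] Hil} (h₁ : x ∈ J₁) (h₂ : x ∈ J₂) :
    IsCompactOperator x := by
  have h : ∀ n, IsCompactOperator ((stripProj Prod.fst).p n * x : Hil →L[ℂ] Hil) := fun n => by
    refine isCompactOperator_of_tendsto ((ProjSeq.tendsto_p_mul h₂).const_mul _)
      (Eventually.of_forall fun m => ?_)
    have := (isCompactOperator_stripProj_mul n m).mul_right x
    simpa only [mul_assoc] using this
  exact isCompactOperator_of_tendsto (ProjSeq.tendsto_p_mul h₁) (Eventually.of_forall h)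

/-- The adjoint ends in a finite-rank projection, so its compactness needs no general theorem on
adjoints of compact operators. -/
lemma isCompactOperator_star_box_mul (T : Hil →L[ℂ] Hil) (n : ℕ) :
    IsCompactOperator
      (star ((stripProj Prod.fst).p n * (stripProj Prod.snd).p n * T) : Hil →L[ℂ] Hil) := by
  rw [star_mul, star_mul, ProjSeq.star_p, ProjSeq.star_p, stripProj_commute]
  exact (isCompactOperator_stripProj_mul n n).mul_left _

lemma tendsto_box_mul {T : Hil →L[ℂ] Hil} (hT : IsCompactOperator T) :
    Tendsto (fun n => (stripProj Prod.fst).p n * (stripProj Prod.snd).p n * T) atTop (𝓝 T) := by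
  have h₁ := ProjSeq.tendsto_p_mul_of_isCompactOperator (tendsto_stripProj_p Prod.fst) hT
  have h₂ := ProjSeq.tendsto_p_mul_of_isCompactOperator (tendsto_stripProj_p Prod.snd) hT
  have h₃ : Tendsto (fun n => (stripProj Prod.fst).p n * ((stripProj Prod.snd).p n * T - T))
      atTop (𝓝 0) := by
    refine squeeze_zero_norm (fun n => ?_) (tendsto_iff_norm_sub_tendsto_zero.1 h₂)
    exact (norm_mul_le _ _).trans
      (mul_le_of_le_one_left (norm_nonneg _) ((stripProj Prod.fst).norm_p_le n))
  simpa [mul_sub, mul_assoc] using h₃.add h₁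

/-- Membership in the ideal needs convergence on both sides, hence compactness of the adjoint too.
The truncations of `T` to boxes have both, and the ideal is closed. -/
lemma mem_stripProj_J_of_isCompactOperator (f : ℤ × ℤ → ℤ) {T : Hil →L[ℂ] Hil}
    (hT : IsCompactOperator T) : T ∈ (stripProj f).J := by
  refine (stripProj f).isClosed_J.mem_of_tendsto (tendsto_box_mul hT)
    (Eventually.of_forall fun n => ?_)
  have hc := (isCompactOperator_stripProj_mul n n).mul_right T
  exact ProjSeq.mem_J_of_tendsto
    (ProjSeq.tendsto_p_mul_of_isCompactOperator (tendsto_stripProj_p f) hc)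
    (ProjSeq.tendsto_mul_p_iff.2 (ProjSeq.tendsto_p_mul_of_isCompactOperator
      (tendsto_stripProj_p f) (isCompactOperator_star_box_mul T n)))

lemma mem_J₁_and_mem_J₂_iff (x : Hil →L[ℂ] Hil) : x ∈ J₁ ∧ x ∈ J₂ ↔ IsCompactOperator x :=
  ⟨fun h => isCompactOperator_of_mem h.1 h.2, fun h =>
    ⟨mem_stripProj_J_of_isCompactOperator _ h, mem_stripProj_J_of_isCompactOperator _ h⟩⟩

lemma mem_𝒜_of_mem_J₁ {x : Hil →L[ℂ] Hil} (hx : x ∈ J₁) : x ∈ 𝒜 :=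
  ⟨ProjSeq.J_le_multiplier hx,
    fun _ hy => mem_stripProj_J_of_isCompactOperator _ (isCompactOperator_mul_of_mem hx hy),
    fun _ hy => mem_stripProj_J_of_isCompactOperator _ (isCompactOperator_mul_of_mem' hx hy)⟩

lemma mem_𝒜_of_mem_J₂ {x : Hil →L[ℂ] Hil} (hx : x ∈ J₂) : x ∈ 𝒜 :=
  ⟨⟨fun _ hy => mem_stripProj_J_of_isCompactOperator _ (isCompactOperator_mul_of_mem' hy hx),
    fun _ hy => mem_stripProj_J_of_isCompactOperator _ (isCompactOperator_mul_of_mem hy hx)⟩,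
    ProjSeq.J_le_multiplier hx⟩

lemma mem_𝒜_of_isCompactOperator {x : Hil →L[ℂ] Hil} (hx : IsCompactOperator x) : x ∈ 𝒜 :=
  mem_𝒜_of_mem_J₁ (mem_stripProj_J_of_isCompactOperator _ hx)

lemma isClosed_𝒜 : IsClosed (𝒜 : Set (Hil →L[ℂ] Hil)) :=
  ProjSeq.isClosed_multiplier_J.inter ProjSeq.isClosed_multiplier_J

/-! ### Membership of Schrödinger operators and potentials. -/

lemma mulOp_mem_multiplier (f : ℤ × ℤ → ℤ) (a : BddFun) :
    mulOp a ∈ multiplier (stripProj f).J := by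
  refine ProjSeq.mem_multiplier (fun n => ⟨n, ?_⟩) fun n => ⟨n, ?_⟩ <;> ext φ x <;>
    simp only [mul_apply_eq_comp, stripProj_p_apply, mulOp_apply] <;> split_ifs <;> simp

/-- A shift by `b` widens a strip by at most `|f b|`. -/
lemma translation_mem_multiplier (f : ℤ × ℤ →+ ℤ) (b : ℤ × ℤ) :
    translation b ∈ multiplier (stripProj f).J := by
  refine ProjSeq.mem_multiplier (fun n => ⟨n + (f b).natAbs, ?_⟩)
      fun n => ⟨n + (f b).natAbs, ?_⟩ <;> ext φ x <;>
    simp only [mul_apply_eq_comp, stripProj_p_apply, translation_apply, map_add]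
  · have : |f x + f b| ≤ n → |f x| ≤ (n + (f b).natAbs : ℕ) := by
      simp only [Int.abs_eq_natAbs]; omega
    split_ifs <;> simp_all
  · have : |f x| ≤ n → |f x + f b| ≤ (n + (f b).natAbs : ℕ) := by
      simp only [Int.abs_eq_natAbs]; omega
    split_ifs <;> simp_all

lemma mulOp_mem_𝒜 (a : BddFun) : mulOp a ∈ 𝒜 :=
  ⟨mulOp_mem_multiplier _ a, mulOp_mem_multiplier _ a⟩

lemma translation_mem_𝒜 (b : ℤ × ℤ) : translation b ∈ 𝒜 :=
  ⟨translation_mem_multiplier (AddMonoidHom.fst ℤ ℤ) b,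
    translation_mem_multiplier (AddMonoidHom.snd ℤ ℤ) b⟩

lemma schrodinger_mem_𝒜 {m : ℕ} (c : Fin m → BddFun) (b : Fin m → ℤ × ℤ) :
    schrodinger c b ∈ 𝒜 :=
  sum_mem fun _ _ => mul_mem (mulOp_mem_𝒜 _) (translation_mem_𝒜 _)

lemma mulOp_mem_J (f : ℤ × ℤ → ℤ) (V : BddFun) (a : ℝ)
    (hV : ∀ x, V x ≠ 0 → |(f x : ℝ)| ≤ a) : mulOp V ∈ (stripProj f).J := by
  obtain ⟨n, hn⟩ := exists_nat_ge a
  have h : ∀ x, V x ≠ 0 → |f x| ≤ n := fun x hx => by exact_mod_cast (hV x hx).trans hn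
  refine (stripProj f).J₀_le_J ((stripProj f).mem_J₀.2 ⟨n, ?_, ?_⟩) <;> ext φ x <;>
    simp only [mul_apply_eq_comp, stripProj_p_apply, mulOp_apply] <;> by_cases hx : V x = 0 <;>
    simp_all

/-! ### The essential spectrum as a union -/

lemma mem_essSpectrum_iff {T : Hil →L[ℂ] Hil} (hT : T ∈ 𝒜) (μ : ℂ) :
    μ ∈ essSpectrum T ↔ μ ∈ σ₁ ⟨T, hT⟩ ∪ σ₂ ⟨T, hT⟩ := by
  have hx : algebraMap ℂ (Hil →L[ℂ] Hil) μ - T ∈ 𝒜 := sub_mem (algebraMap_mem 𝒜 μ) hT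
  set x := algebraMap ℂ (Hil →L[ℂ] Hil) μ - T with hx_def
  have e₀ : μ ∉ essSpectrum T ↔ IsUnit (Ideal.Quotient.mk (compactIdeal Hil) x) := by
    rw [essSpectrum, spectrum.notMem_iff]; rfl
  have e₁ : μ ∉ σ₁ ⟨T, hT⟩ ↔ IsUnit (Ideal.Quotient.mk (idealIn 𝒜 J₁ 𝒜_le₁) ⟨x, hx⟩) := by
    rw [σ₁, spectrum.notMem_iff]; rfl
  have e₂ : μ ∉ σ₂ ⟨T, hT⟩ ↔ IsUnit (Ideal.Quotient.mk (idealIn 𝒜 J₂ 𝒜_le₂) ⟨x, hx⟩) := by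
    rw [σ₂, spectrum.notMem_iff]; rfl
  rw [← not_iff_not, Set.mem_union, not_or, e₀, e₁, e₂]
  simp only [isUnit_quotient_mk_iff]
  constructor
  · rintro ⟨⟨y, hy⟩, ⟨z, hz⟩⟩
    obtain ⟨y', hy'A, hy'⟩ := exists_left_parametrix 𝒜 isClosed_𝒜
      (fun _ => mem_𝒜_of_isCompactOperator) hx (y := y) hy
    -- A right parametrix is the adjoint of a left parametrix of `star x`. Compactness passes to
    -- adjoints because `J₁` and `J₂` are `*`-closed.
    obtain ⟨z', hz'A, hz'⟩ := exists_left_parametrix 𝒜 isClosed_𝒜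
      (fun _ => mem_𝒜_of_isCompactOperator) (star_mem hx) (y := star z) (by
        have h := (mem_J₁_and_mem_J₂_iff _).2 hz
        have := (mem_J₁_and_mem_J₂_iff _).1 ⟨star_mem h.1, star_mem h.2⟩
        simpa using this)
    have hz'' : 1 - x * star z' ∈ J₁ ∧ 1 - x * star z' ∈ J₂ := by
      have h := (mem_J₁_and_mem_J₂_iff _).2 hz'
      have := And.intro (star_mem h.1) (star_mem h.2)
      simpa using this
    rw [← mem_J₁_and_mem_J₂_iff] at hy'
    exact ⟨⟨⟨⟨y', hy'A⟩, hy'.1⟩, ⟨⟨star z', star_mem hz'A⟩, hz''.1⟩⟩,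
      ⟨⟨⟨y', hy'A⟩, hy'.2⟩, ⟨⟨star z', star_mem hz'A⟩, hz''.2⟩⟩⟩
  · rintro ⟨⟨⟨y₁, hy₁⟩, ⟨z₁, hz₁⟩⟩, ⟨⟨y₂, hy₂⟩, ⟨z₂, hz₂⟩⟩⟩
    -- Chosen so that the error factors into one element of `J₁` times one of `J₂`.
    refine ⟨⟨y₁ + y₂ - y₁ * x * y₂, ?_⟩, ⟨z₁ + z₂ - z₁ * x * z₂, ?_⟩⟩
    · have h := isCompactOperator_mul_of_mem (x := 1 - y₁ * x) (y := 1 - y₂ * x) hy₁ hy₂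
      have e : 1 - (y₁ + y₂ - y₁ * x * y₂) * x = (1 - y₁ * x) * (1 - y₂ * x) := by noncomm_ring
      rw [e]; exact h
    · have h := isCompactOperator_mul_of_mem (x := 1 - x * z₁) (y := 1 - x * z₂) hz₁ hz₂
      have e : 1 - x * (z₁ + z₂ - z₁ * x * z₂) = (1 - x * z₁) * (1 - x * z₂) := by noncomm_ring
      rw [e]; exact h

lemma σ₁_congr {x y : 𝒜} (h : (x : Hil →L[ℂ] Hil) - y ∈ J₁) : σ₁ x = σ₁ y := by
  rw [σ₁, σ₁, (Ideal.Quotient.mk_eq_mk_iff_sub_mem x y).2 h]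

lemma σ₂_congr {x y : 𝒜} (h : (x : Hil →L[ℂ] Hil) - y ∈ J₂) : σ₂ x = σ₂ y := by
  rw [σ₂, σ₂, (Ideal.Quotient.mk_eq_mk_iff_sub_mem x y).2 h]

/-! ### Periodic operators -/

lemma norm_translation (b : ℤ × ℤ) (φ : Hil) : ‖translation b φ‖ = ‖φ‖ := by
  rw [← sq_eq_sq₀ (norm_nonneg _) (norm_nonneg _), Hil.norm_sq_eq_tsum, Hil.norm_sq_eq_tsum]
  exact (Equiv.addRight b).tsum_eq fun x => ‖φ x‖ ^ 2

lemma translation_mul (a b : ℤ × ℤ) : translation a * translation b = translation (a + b) := by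
  ext φ x
  simp [mul_apply_eq_comp, add_assoc]

lemma translation_zero : translation 0 = 1 := by
  ext φ x
  simp

lemma translation_nsmul (n : ℕ) (b : ℤ × ℤ) : translation (n • b) = translation b ^ n := by
  induction n with
  | zero => simp [translation_zero]
  | succ n ih => rw [succ_nsmul, ← translation_mul, ih, pow_succ]

lemma star_translation (b : ℤ × ℤ) : star (translation b) = translation (-b) := by
  have h : star (translation b) * translation b = 1 := by
    rw [ContinuousLinearMap.star_eq_adjoint, ContinuousLinearMap.mul_def,
      ← ContinuousLinearMap.norm_map_iff_adjoint_comp_self]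
    exact norm_translation b
  calc star (translation b) = star (translation b) * (translation b * translation (-b)) := by
        rw [translation_mul, add_neg_cancel, translation_zero, mul_one]
    _ = translation (-b) := by rw [← mul_assoc, h, one_mul]

lemma commute_translation_star {x : Hil →L[ℂ] Hil} {b : ℤ × ℤ} (h : Commute (translation b) x) :
    Commute (translation (-b)) (star x) := by
  rw [← star_translation]
  exact h.star_star

lemma tendsto_mul_translation (f : ℤ × ℤ →+ ℤ) {b : ℤ × ℤ} (hb : f b ≠ 0) {k : Hil →L[ℂ] Hil}
    (hk : k ∈ (stripProj f).J) (φ : Hil) :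
    Tendsto (fun n : ℕ => k (translation (n • b) φ)) atTop (𝓝 0) := by
  have h1 : ∀ m, Tendsto (fun n : ℕ => (stripProj f).p m (translation (n • b) φ)) atTop
      (𝓝 0) := fun m => by
    -- Translating back preserves norms and turns this into cutting the fixed vector `φ` to a strip
    -- that moves off to infinity.
    have h : Tendsto
        (fun n : ℕ => translation (-(n • b)) ((stripProj f).p m (translation (n • b) φ)))
        atTop (𝓝 0) := by
      refine Hil.tendsto_zero_of_dominated φ (fun n x => ?_) fun x => ?_
      · rw [translation_apply, stripProj_p_apply, translation_apply, neg_add_cancel_right]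
        split_ifs <;> simp
      -- As `|f b| ≥ 1`, this gives `|f x - n * f b| ≥ n - |f x| > m`.
      · filter_upwards [eventually_gt_atTop (m + (f x).natAbs)] with n hn
        rw [translation_apply, stripProj_p_apply, if_neg]
        have h2 : n ≤ |(n : ℤ) * f b| := by
          rw [abs_mul, Nat.abs_cast]
          exact le_mul_of_one_le_right (by positivity) (Int.one_le_abs hb)
        have h3 : f (x + -(n • b)) = f x - n * f b := by
          rw [map_add, map_neg, map_nsmul, nsmul_eq_mul, sub_eq_add_neg]
        rw [h3]
        simp only [Int.abs_eq_natAbs] at h2 ⊢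
        omega
    rw [tendsto_zero_iff_norm_tendsto_zero] at h ⊢
    simpa only [norm_translation] using h
  rw [Metric.tendsto_atTop]
  intro ε hε
  obtain ⟨m, hm⟩ := (Metric.tendsto_atTop.1 (ProjSeq.tendsto_mul_p hk)
    (ε / (2 * (‖φ‖ + 1))) (by positivity))
  have h2 : Tendsto (fun n : ℕ => k ((stripProj f).p m (translation (n • b) φ))) atTop (𝓝 0) := by
    have := (k.continuous.tendsto 0).comp (h1 m)
    rwa [map_zero] at this
  obtain ⟨N, hN⟩ := Metric.tendsto_atTop.1 h2 (ε / 2) (half_pos hε)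
  refine ⟨N, fun n hn => ?_⟩
  have h3 := hN n hn
  have h4 := hm m le_rfl
  rw [dist_zero_right] at h3 ⊢
  rw [dist_eq_norm] at h4
  set ψ := translation (n • b) φ with hψ
  have h5 : ‖ψ‖ = ‖φ‖ := norm_translation _ _
  have h6 : ‖(k * (stripProj f).p m - k) ψ‖ ≤ ε / 2 := by
    refine (ContinuousLinearMap.le_opNorm _ _).trans ?_
    rw [h5]
    calc _ ≤ ε / (2 * (‖φ‖ + 1)) * (‖φ‖ + 1) := by gcongr; linarith
      _ = ε / 2 := by field_simp
  have h7 : k ψ = k ((stripProj f).p m ψ) - (k * (stripProj f).p m - k) ψ := by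
    simp
  rw [h7]
  exact (norm_sub_le _ _).trans_lt (by linarith)

/-- Apply `ψ = y x ψ + (1 - y x) ψ` to far translates `ψ` of `φ`: the norms of `ψ` and `x ψ` do not
change, while the last term tends to zero. The parametrix `y` need not commute with the translation.
-/
lemma norm_le_of_commute (f : ℤ × ℤ →+ ℤ) {b : ℤ × ℤ} (hb : f b ≠ 0) {x y : Hil →L[ℂ] Hil}
    (hx : Commute (translation b) x) (h : 1 - y * x ∈ (stripProj f).J) (φ : Hil) :
    ‖φ‖ ≤ ‖y‖ * ‖x φ‖ := by
  have h1 := (tendsto_mul_translation f hb h φ).norm.const_add (‖y‖ * ‖x φ‖)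
  rw [norm_zero, add_zero] at h1
  refine ge_of_tendsto h1 (Eventually.of_forall fun n => ?_)
  have hc : x (translation (n • b) φ) = translation (n • b) (x φ) := by
    rw [translation_nsmul]
    exact (DFunLike.congr_fun (hx.pow_left n) φ).symm
  set ψ := translation (n • b) φ with hψ
  have h2 : ψ = y (x ψ) + (1 - y * x) ψ := by simp
  calc ‖φ‖ = ‖ψ‖ := (norm_translation _ _).symm
    _ = ‖y (x ψ) + (1 - y * x) ψ‖ := by rw [← h2]
    _ ≤ ‖y‖ * ‖x ψ‖ + ‖(1 - y * x) ψ‖ :=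
      (norm_add_le _ _).trans (by gcongr; exact y.le_opNorm _)
    _ = _ := by rw [hc, norm_translation]

/-- An operator that commutes with a translation transversal to a strip is invertible as soon as
it is invertible modulo the ideal of that strip. -/
lemma isUnit_of_commute (f : ℤ × ℤ →+ ℤ) {b : ℤ × ℤ} (hb : f b ≠ 0) {x y z : Hil →L[ℂ] Hil}
    (hx : Commute (translation b) x) (hy : 1 - y * x ∈ (stripProj f).J)
    (hz : 1 - x * z ∈ (stripProj f).J) : IsUnit x := by
  refine isUnit_of_bounded_below (norm_le_of_commute f hb hx hy)
    (norm_le_of_commute f (b := -b) (y := star z) (by simpa using hb)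
      (commute_translation_star hx) ?_)
  have := star_mem hz
  simpa using this

lemma spectrum_quotient_eq_of_commute (f : ℤ × ℤ →+ ℤ) (S : StarSubalgebra ℂ (Hil →L[ℂ] Hil))
    (hS : S ≤ multiplier (stripProj f).J) (hcl : IsClosed (S : Set (Hil →L[ℂ] Hil)))
    {b : ℤ × ℤ} (hb : f b ≠ 0) (T : S) (hT : Commute (translation b) (T : Hil →L[ℂ] Hil)) :
    spectrum ℂ (Ideal.Quotient.mk (idealIn S (stripProj f).J hS) T) =
      spectrum ℂ (T : Hil →L[ℂ] Hil) := by
  ext μ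
  rw [← not_iff_not, spectrum.notMem_iff, spectrum.notMem_iff]
  have e : algebraMap ℂ _ μ - Ideal.Quotient.mk (idealIn S (stripProj f).J hS) T =
    Ideal.Quotient.mk (idealIn S (stripProj f).J hS) (algebraMap ℂ S μ - T) := rfl
  rw [e]
  constructor
  · rw [isUnit_quotient_mk_iff]
    rintro ⟨⟨y, hy⟩, ⟨z, hz⟩⟩
    exact isUnit_of_commute f hb ((show Commute _ _ from (Algebra.commutes μ _).symm).sub_right hT) hy hz
  · intro h
    -- Spectral permanence again: an inverse among all bounded operators already lies in `S`.
    have := hcl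
    exact ((S.coe_isUnit (a := algebraMap ℂ S μ - T)).1 h).map _

lemma exists_commute_translation {T : Hil →L[ℂ] Hil} {V : BddFun} {e : ℤ × ℤ}
    (hT : IsPeriodicOp e T) (hV : IsPeriodicFun e V) :
    ∃ k : ℕ, 0 < k ∧ Commute (translation (k • e)) (T + mulOp V) := by
  obtain ⟨k, hk, hkT⟩ := hT
  obtain ⟨l, hl, hlV⟩ := hV
  -- A common multiple of the two periods.
  refine ⟨l * k, by positivity, Commute.add_right ?_ ?_⟩
  · rw [mul_nsmul', translation_nsmul]
    exact Commute.pow_left hkT l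
  · have h : Commute (translation (l • e)) (mulOp V) := by
      ext φ x
      rw [mul_apply_eq_comp, mul_apply_eq_comp, translation_apply, mulOp_apply, mulOp_apply,
        translation_apply, hlV]
    rw [mul_comm, mul_nsmul', translation_nsmul]
    exact h.pow_left k

end CrossSpectrum

end

open CrossSpectrum in
theorem mainTheorem1 {m : ℕ} (c : Fin m → BddFun) (b : Fin m → ℤ × ℤ) (V₁ V₂ : BddFun)
    (hA₁ : IsPeriodicOp (1, 0) (schrodinger c b)) (hA₂ : IsPeriodicOp (0, 1) (schrodinger c b))
    (a₁ a₂ : ℝ) (hV₁ : ∀ i j : ℤ, V₁ (i, j) ≠ 0 → |(j : ℝ)| ≤ a₂)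
    (hV₂ : ∀ i j : ℤ, V₂ (i, j) ≠ 0 → |(i : ℝ)| ≤ a₁) :
    (∀ x ∈ J₁, x ∈ 𝒜) ∧ (∀ x ∈ J₂, x ∈ 𝒜) ∧
    (∀ x : Hil →L[ℂ] Hil, (x ∈ J₁ ∧ x ∈ J₂) ↔ IsCompactOperator x) ∧
    schrodinger c b + mulOp V₁ + mulOp V₂ ∈ 𝒜 ∧
    (∃ (h₁ : schrodinger c b + mulOp V₁ ∈ 𝒜) (h₂ : schrodinger c b + mulOp V₂ ∈ 𝒜),
      essSpectrum (schrodinger c b + mulOp V₁ + mulOp V₂) =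
        σ₁ ⟨schrodinger c b + mulOp V₁, h₁⟩ ∪ σ₂ ⟨schrodinger c b + mulOp V₂, h₂⟩) ∧
    (IsPeriodicFun (1, 0) V₁ → IsPeriodicFun (0, 1) V₂ →
      essSpectrum (schrodinger c b + mulOp V₁ + mulOp V₂) =
        spectrum ℂ (schrodinger c b + mulOp V₁) ∪ spectrum ℂ (schrodinger c b + mulOp V₂)) := by
  have hA := schrodinger_mem_𝒜 c b
  have hA₁V₁ := add_mem hA (mulOp_mem_𝒜 V₁)
  have hA₂V₂ := add_mem hA (mulOp_mem_𝒜 V₂)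
  have hH := add_mem hA₁V₁ (mulOp_mem_𝒜 V₂)
  have hV₁J : mulOp V₁ ∈ J₂ := mulOp_mem_J _ V₁ a₂ fun x hx => hV₁ x.1 x.2 hx
  have hV₂J : mulOp V₂ ∈ J₁ := mulOp_mem_J _ V₂ a₁ fun x hx => hV₂ x.1 x.2 hx
  have hess : essSpectrum (schrodinger c b + mulOp V₁ + mulOp V₂) =
      σ₁ ⟨schrodinger c b + mulOp V₁, hA₁V₁⟩ ∪ σ₂ ⟨schrodinger c b + mulOp V₂, hA₂V₂⟩ := by
    -- The full operator differs from the two partial ones by `V₂ ∈ J₁` and `V₁ ∈ J₂`.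
    rw [← σ₁_congr (x := ⟨_, hH⟩) (y := ⟨_, hA₁V₁⟩) (by simpa using hV₂J),
      ← σ₂_congr (x := ⟨_, hH⟩) (y := ⟨_, hA₂V₂⟩) (by simpa [add_right_comm] using hV₁J)]
    exact Set.ext (mem_essSpectrum_iff hH)
  refine ⟨fun _ => mem_𝒜_of_mem_J₁, fun _ => mem_𝒜_of_mem_J₂, mem_J₁_and_mem_J₂_iff, hH,
    ⟨hA₁V₁, hA₂V₂, hess⟩, fun hp₁ hp₂ => ?_⟩
  obtain ⟨k, hk, hk'⟩ := exists_commute_translation hA₁ hp₁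
  obtain ⟨l, hl, hl'⟩ := exists_commute_translation hA₂ hp₂
  have h₁ := spectrum_quotient_eq_of_commute (AddMonoidHom.fst ℤ ℤ) 𝒜 𝒜_le₁ isClosed_𝒜
    (by simpa using hk.ne') ⟨_, hA₁V₁⟩ hk'
  have h₂ := spectrum_quotient_eq_of_commute (AddMonoidHom.snd ℤ ℤ) 𝒜 𝒜_le₂ isClosed_𝒜
    (by simpa using hl.ne') ⟨_, hA₂V₂⟩ hl'
  rw [hess]
  exact congrArg₂ (· ∪ ·) h₁ h₂
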